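/- Let $d\ge 1$ and let $w:\mathbb{R}^d\to\mathbb{R}$ be a kernel such that $w\in L^1_{\mathrm{loc}}(\mathbb{R}^d\setminus\{0\})$, $w\ge 0$, $w$ is radial, $w(x)>0$ for $0<|x|\le\epsilon_0$ for some $\epsilon_0\in(0,1)$, and $\int_{\mathbb{R}^d}\min(1,|x|)\,w(x)\,dx<\infty$. Assume in addition that at least one of the following holds: 1. $\int_{\mathbb{R}^d}|x|\,w(x)\,dx<\infty$; 2. there are $R>0$, $c_0>0$ and $\alpha\in(0,1]$ such that $w(x)=c_0|x|^{-d-\alpha}$ whenever $|x|>R$. Let $\nu\in\mathbb{R}^d$ be a unit vector, and let $\chi_\nu$ be the characteristic function of $\{z: z\cdot\nu\ge 0\}$. For a vector field $\phi\in C_c^\infty(\mathbb{R}^d;\mathbb{R}^d)$ put $$\mathcal{D}_w^{\nu}\phi(x)=\lim_{\epsilon\to0^+}\int_{\mathbb{R}^d\setminus B_\epsilon(x)}\chi_\nu(y-x)\,\frac{y-x}{|y-x|}\cdot(\phi(y)-\phi(x))\,w(y-x)\,dy ,$$ and for $u\in L^2(\mathbb{R}^d)$ let the distribution $\mathfrak{G}_w^\nu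 u$ be given by $\langle\mathfrak{G}_w^\nu u,\phi\rangle=-\int_{\mathbb{R}^d}u\,\mathcal{D}_w^{-\nu}\phi\,dx$ for all $\phi\in C_c^\infty(\mathbb{R}^d;\mathbb{R}^d)$. Let $\Omega\subset\mathbb{R}^d$ be a bounded domain (open and connected) with a continuous boundary, that is, near each point of $\partial\Omega$ the set $\Omega$ coincides, up to a rigid motion, with $\{(x',x_d): x_d>\zeta(x')\}$ for some continuous $\zeta:\mathbb{R}^{d-1}\to\mathbb{R}$. Let $$\mathcal{S}_w^\nu(\Omega)=\{u\in L^2(\mathbb{R}^d): u=0\text{ a.e. on }\mathbb{R}^d\setminus\Omega,\ \mathfrak{G}_w^\nu u\in L^2(\mathbb{R}^d;\mathbb{R}^d)\}.$$ Then there is a constant $\Pi=\Pi(w,\Omega,\nu)>0$ such that $$\|u\|_{L^2(\Omega)}\le \Pi\,\|\mathfrak{G}_w^\nu u\|_{L^2(\mathbb{R}^d;\mathbb{R}^d)}\qquad\text{for all }u\in\mathcal{S}_w^\nu(\Omega).$$ -/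

import Mathlib

open MeasureTheory Filter Topology
open scoped ContDiff

noncomputable section

namespace NonlocalHalfBall

/-- Euclidean space of dimension `d`. -/
abbrev E (d : ℕ) := EuclideanSpace ℝ (Fin d)

/-- The standing assumptions on a kernel `w`: it is locally integrable away from the origin,
nonnegative, radial, positive in a punctured neighbourhood of the origin, and
`∫ min (1, |x|) w(x) dx < ∞`. The value of `w` at the origin is irrelevant. -/
structure IsKernel {d : ℕ} (w : E d → ℝ) : Prop where
  locallyIntegrable : LocallyIntegrableOn w {0}ᶜ volume
  nonneg : ∀ x, x ≠ 0 → 0 ≤ w x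
  radial : ∀ x y, ‖x‖ = ‖y‖ → w x = w y
  pos_near_zero : ∃ ε₀ : ℝ, 0 < ε₀ ∧ ε₀ < 1 ∧ ∀ x, 0 < ‖x‖ → ‖x‖ ≤ ε₀ → 0 < w x
  integrable_min : Integrable (fun x => min 1 ‖x‖ * w x) volume

/-- The kernel has a finite first moment. -/
def HasFiniteFirstMoment {d : ℕ} (w : E d → ℝ) : Prop :=
  Integrable (fun x => ‖x‖ * w x) volume

/-- The kernel equals `c₀ / |x| ^ (d + α)`, with `c₀ > 0` and `α ∈ (0, 1]`, outside some ball. -/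
def IsFractionalAtInfinity {d : ℕ} (w : E d → ℝ) : Prop :=
  ∃ R c₀ α : ℝ, 0 < R ∧ 0 < c₀ ∧ 0 < α ∧ α ≤ 1 ∧
    ∀ x, R < ‖x‖ → w x = c₀ / ‖x‖ ^ ((d : ℝ) + α)

/-- Characteristic function of the half-space `{z | z · ν ≥ 0}`. -/
def halfSpaceChar {d : ℕ} (ν : E d) : E d → ℝ :=
  Set.indicator {z | 0 ≤ inner ℝ z ν} (fun _ => 1)

/-- The nonlocal half-ball divergence of a vector field, in the principal value sense:
`lim_{ε → 0+} ∫_{ℝᵈ \ B_ε(x)} χ_ν(y - x) (y - x)/|y - x| · (v(y) - v(x)) w(y - x) dy`. -/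
def nonlocalDiv {d : ℕ} (w : E d → ℝ) (ν : E d) (v : E d → E d) (x : E d) : ℝ :=
  limUnder (𝓝[>] (0 : ℝ)) fun ε =>
    ∫ y in (Metric.ball x ε)ᶜ,
      halfSpaceChar ν (y - x) * inner ℝ (‖y - x‖⁻¹ • (y - x)) (v y - v x) * w (y - x)

/-- The distributional nonlocal half-ball gradient of `u`, as a functional on test fields:
`⟨𝔊 u, φ⟩ = - ∫ u(x) (D_w^{-ν} φ)(x) dx`. -/
def distribGrad {d : ℕ} (w : E d → ℝ) (ν : E d) (u : E d → ℝ) (φ : E d → E d) : ℝ :=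
  -∫ x, u x * nonlocalDiv w (-ν) φ x

/-- The distributional gradient of `u` is (given by) the square integrable vector field `g`. -/
def IsL2Gradient {d : ℕ} (w : E d → ℝ) (ν : E d) (u : E d → ℝ) (g : E d → E d) : Prop :=
  MemLp g 2 volume ∧
    ∀ φ : E d → E d, ContDiff ℝ ∞ φ → HasCompactSupport φ →
      distribGrad w ν u φ = ∫ x, inner ℝ (g x) (φ x)

/-- The nonlocal Sobolev-type space: square integrable functions on `ℝᵈ` vanishing a.e. outside
`Ω`, whose distributional nonlocal gradient is square integrable. -/
def nonlocalSobolev {d : ℕ} (w : E d → ℝ) (ν : E d) (Ω : Set (E d)) : Set (E d → ℝ) :=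
  {u | MemLp u 2 volume ∧ (∀ᵐ x ∂volume, x ∉ Ω → u x = 0) ∧ ∃ g, IsL2Gradient w ν u g}

/-- `Ω` has a continuous boundary: near each boundary point, after a rigid motion of the
coordinates `x ↦ (x', x_d)`, `Ω` is the region above the graph of a continuous function. -/
def HasContinuousBoundary {d : ℕ} (Ω : Set (E d)) : Prop :=
  ∀ x₀ ∈ frontier Ω, ∃ r : ℝ, 0 < r ∧
    ∃ (Φ : E d ≃ᵢ WithLp 2 (E (d - 1) × ℝ)) (ζ : E (d - 1) → ℝ), Continuous ζ ∧
      ∀ x ∈ Metric.ball x₀ r, x ∈ Ω ↔ ζ (Φ x).fst < (Φ x).snd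

end NonlocalHalfBall

end

/-!
The inequality needs only the component of the gradient along `ν`. Testing with fields `ψ ν` turns
the principal value into the absolutely convergent operator `(L ψ)(x) = ∫ k(z) (ψ(x + z) - ψ(x)) dz`,
where `k(z) = χ_{-ν}(z) |z · ν| / |z| w(z) ≥ 0` (`nonlocalDiv_neg_smul_eq`), and `h = g · ν` satisfies
`∫ u L ψ = ∫ h ψ` for all test functions `ψ`.

For a test function `v`, Fubini and translation invariance give
`-∫ v L v = 1/2 ∫ k(z) A(z) dz` with `A(z) = ∫ |v(x + z) - v(x)|² dx`
(`integral_mul_jumpOperator`). By the triangle inequality `A(m z) ≤ m² A(z)`, and as soon as `m |z|`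
exceeds the diameter of the support of `v` the two translates are orthogonal, so that
`A(m z) = 2 ∫ v²`. As `k > 0` on a half annulus around the origin, this yields
`c ∫ v² ≤ -∫ v L v`, with `c > 0` depending only on `k` and on the support
(`integral_sq_le_neg_integral_mul_jumpOperator`).

To reach `u` itself, let `v = ρ * u` be a mollification. Testing the weak equation with the
translates `v(· + t)` and averaging against `ρ(t)` gives `∫ v L v = ∫ ρ(t) ∫ h(x) v(x + t) dx dt`
(`integral_mollification_mul_jumpOperator`); with Young's inequality, `c ‖v‖ ≤ ‖h‖` in `L²`. Since
`ρ * u → u` almost everywhere as the support of `ρ` shrinks to a point, Fatou's lemma concludes.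
-/

open scoped Convolution

set_option linter.unusedSectionVars false

namespace NonlocalHalfBall

section JumpOperator

variable {F : Type*} [NormedAddCommGroup F] [NormedSpace ℝ F] [FiniteDimensional ℝ F]
  [MeasurableSpace F] [BorelSpace F] {μ : Measure F} [μ.IsAddHaarMeasure]

/-! ### The jump operator of a nonnegative kernel -/

/-- The operator `(L ψ)(x) = ∫ k(z) (ψ(x + z) - ψ(x)) dz` with jump kernel `k`. For a kernel
satisfying `∫ min (1, |z|) k(z) dz < ∞` the integral converges absolutely when `ψ` is bounded and
Lipschitz, so that no principal value is needed. -/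
noncomputable def jumpOperator (μ : Measure F) (k ψ : F → ℝ) (x : F) : ℝ :=
  ∫ z, k z * (ψ (x + z) - ψ x) ∂μ

theorem exists_abs_sub_le_mul_min {ψ : F → ℝ} (hψ : ContDiff ℝ ∞ ψ) (hc : HasCompactSupport ψ) :
    ∃ B, ∀ x z, |ψ (x + z) - ψ x| ≤ B * min 1 ‖z‖ := by
  obtain ⟨M, hM⟩ := hc.exists_bound_of_continuous hψ.continuous
  obtain ⟨K, hK⟩ := hψ.lipschitzWith_of_hasCompactSupport hc (by simp)
  refine ⟨max (2 * M) K, fun x z => ?_⟩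
  rcases le_total 1 ‖z‖ with h | h
  · rw [min_eq_left h, mul_one]
    have h1 := hM (x + z)
    have h2 := hM x
    rw [Real.norm_eq_abs] at h1 h2
    exact (abs_sub _ _).trans (le_max_of_le_left (by linarith))
  · rw [min_eq_right h]
    have := hK.dist_le_mul (x + z) x
    rw [Real.dist_eq, dist_self_add_left] at this
    exact this.trans (by gcongr; exact le_max_right _ _)

section

variable {k ψ : F → ℝ} {B : ℝ}

theorem norm_mul_sub_le (hk : ∀ z, 0 ≤ k z)
    (hB : ∀ x z, |ψ (x + z) - ψ x| ≤ B * min 1 ‖z‖) (x z : F) :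
    ‖k z * (ψ (x + z) - ψ x)‖ ≤ B * (min 1 ‖z‖ * k z) := by
  rw [norm_mul, Real.norm_eq_abs, Real.norm_eq_abs, abs_of_nonneg (hk z)]
  calc k z * |ψ (x + z) - ψ x| ≤ k z * (B * min 1 ‖z‖) := by gcongr; exacts [hk z, hB x z]
    _ = _ := by ring

theorem integrable_jump (hkm : AEStronglyMeasurable k μ) (hk : ∀ z, 0 ≤ k z)
    (hki : Integrable (fun z => min 1 ‖z‖ * k z) μ) (hψ : Continuous ψ)
    (hB : ∀ x z, |ψ (x + z) - ψ x| ≤ B * min 1 ‖z‖) (x : F) :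
    Integrable (fun z => k z * (ψ (x + z) - ψ x)) μ := by
  refine (hki.const_mul B).mono' ?_ (ae_of_all _ (norm_mul_sub_le hk hB x))
  exact hkm.mul (by fun_prop : Continuous fun z => ψ (x + z) - ψ x).aestronglyMeasurable

theorem continuous_jumpOperator (hkm : AEStronglyMeasurable k μ) (hk : ∀ z, 0 ≤ k z)
    (hki : Integrable (fun z => min 1 ‖z‖ * k z) μ) (hψ : Continuous ψ)
    (hB : ∀ x z, |ψ (x + z) - ψ x| ≤ B * min 1 ‖z‖) :
    Continuous (jumpOperator μ k ψ) := by
  refine continuous_of_dominated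
    (fun x => (integrable_jump hkm hk hki hψ hB x).aestronglyMeasurable)
    (fun x => ae_of_all _ (norm_mul_sub_le hk hB x)) (hki.const_mul B)
    (ae_of_all _ fun z => by fun_prop)

theorem norm_jumpOperator_le (hk : ∀ z, 0 ≤ k z)
    (hki : Integrable (fun z => min 1 ‖z‖ * k z) μ)
    (hB : ∀ x z, |ψ (x + z) - ψ x| ≤ B * min 1 ‖z‖) (x : F) :
    ‖jumpOperator μ k ψ x‖ ≤ ∫ z, B * (min 1 ‖z‖ * k z) ∂μ :=
  norm_integral_le_of_norm_le (hki.const_mul B) (ae_of_all _ (norm_mul_sub_le hk hB x))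

theorem jumpOperator_comp_add_right (t x : F) :
    jumpOperator μ k (fun y => ψ (y + t)) x = jumpOperator μ k ψ (x + t) := by
  simp only [jumpOperator, add_right_comm]

end

/-! ### The energy of a compactly supported function -/

/-- The squared `L²` distance between `v` and its translate by `z`. -/
noncomputable def translationEnergy (μ : Measure F) (v : F → ℝ) (z : F) : ℝ :=
  ∫ x, (v (x + z) - v x) ^ 2 ∂μ

section

variable {v : F → ℝ}

theorem hasCompactSupport_comp_add_right (hvc : HasCompactSupport v) (z : F) :
    HasCompactSupport fun x => v (x + z) :=
  hvc.comp_homeomorph (Homeomorph.addRight z)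

theorem translationEnergy_nonneg (z : F) : 0 ≤ translationEnergy μ v z :=
  integral_nonneg fun _ => sq_nonneg _

theorem integrable_sub_sq (hv : Continuous v) (hvc : HasCompactSupport v) (a b : F) :
    Integrable (fun x => (v (x + a) - v (x + b)) ^ 2) μ := by
  refine Continuous.integrable_of_hasCompactSupport (by fun_prop) ?_
  have := (hasCompactSupport_comp_add_right hvc a).sub (hasCompactSupport_comp_add_right hvc b)
  exact this.comp_left (g := fun s : ℝ => s ^ 2) (by simp)

theorem integrable_sq (hv : Continuous v) (hvc : HasCompactSupport v) :
    Integrable (fun x => v x ^ 2) μ :=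
  Continuous.integrable_of_hasCompactSupport (by fun_prop)
    (hvc.comp_left (g := fun s : ℝ => s ^ 2) (by simp))

/-- The triangle inequality in `L²`, applied to `m` successive translations by `z`. -/
theorem translationEnergy_nsmul_le (hv : Continuous v) (hvc : HasCompactSupport v) (m : ℕ)
    (z : F) : translationEnergy μ v (m • z) ≤ (m : ℝ) ^ 2 * translationEnergy μ v z := by
  have hpt : ∀ x, (v (x + m • z) - v x) ^ 2 ≤
      m * ∑ i ∈ Finset.range m, (v (x + (i + 1) • z) - v (x + i • z)) ^ 2 := fun x => by
    have h := Finset.sum_range_sub (fun i : ℕ => v (x + i • z)) m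
    simp only [zero_smul, add_zero] at h
    rw [← h]
    simpa using sq_sum_le_card_mul_sum_sq (s := Finset.range m)
      (f := fun i : ℕ => v (x + (i + 1) • z) - v (x + i • z))
  have hstep : ∀ i : ℕ, ∫ x, (v (x + (i + 1) • z) - v (x + i • z)) ^ 2 ∂μ =
      translationEnergy μ v z := fun i => by
    rw [translationEnergy, ← integral_add_right_eq_self (fun x => (v (x + z) - v x) ^ 2) (i • z)]
    simp only [succ_nsmul, add_assoc]
  calc translationEnergy μ v (m • z)
      ≤ ∫ x, m * ∑ i ∈ Finset.range m, (v (x + (i + 1) • z) - v (x + i • z)) ^ 2 ∂μ := by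
        refine integral_mono (by simpa using integrable_sub_sq hv hvc (m • z) 0) ?_ hpt
        exact (integrable_finsetSum _ fun i _ => integrable_sub_sq hv hvc _ _).const_mul _
    _ = (m : ℝ) ^ 2 * translationEnergy μ v z := by
        rw [integral_const_mul, integral_finsetSum _ fun i _ => integrable_sub_sq hv hvc _ _]
        simp only [hstep, Finset.sum_const, Finset.card_range, nsmul_eq_mul]
        ring

theorem integral_mul_translate_sub (hv : Continuous v) (hvc : HasCompactSupport v) (z : F) :
    ∫ x, v x * (v (x + z) - v x) ∂μ = -(translationEnergy μ v z / 2) := by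
  have h1 : Integrable (fun x => v (x + z) ^ 2) μ := (integrable_sq hv hvc).comp_add_right z
  have h0 := integrable_sq (μ := μ) hv hvc
  have h2 : Integrable (fun x => (v (x + z) - v x) ^ 2) μ := by
    simpa using integrable_sub_sq hv hvc z 0
  have hz : ∫ x, v (x + z) ^ 2 ∂μ = ∫ x, v x ^ 2 ∂μ :=
    integral_add_right_eq_self (fun x => v x ^ 2) z
  have : ∀ x, v x * (v (x + z) - v x) =
      (v (x + z) ^ 2 - v x ^ 2 - (v (x + z) - v x) ^ 2) / 2 := fun x => by ring
  simp_rw [this]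
  have h3 : ∫ x, (v (x + z) ^ 2 - v x ^ 2 - (v (x + z) - v x) ^ 2) ∂μ =
      ∫ x, (v (x + z) ^ 2 - v x ^ 2) ∂μ - ∫ x, (v (x + z) - v x) ^ 2 ∂μ :=
    integral_sub (h1.sub h0) h2
  rw [integral_div, h3, integral_sub h1 h0, hz, translationEnergy]
  ring

/-- Once a translation moves the support of `v` off itself, the two translates are orthogonal. -/
theorem translationEnergy_eq_two_mul (hv : Continuous v) (hvc : HasCompactSupport v) {R : ℝ}
    (hR : Function.support v ⊆ Metric.closedBall 0 R) {z : F} (hz : 2 * R < ‖z‖) :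
    translationEnergy μ v z = 2 * ∫ x, v x ^ 2 ∂μ := by
  have h0 : ∀ x, v x * v (x + z) = 0 := fun x => by
    by_contra h
    obtain ⟨h1, h2⟩ := mul_ne_zero_iff.1 h
    have h1' := mem_closedBall_zero_iff.1 (hR h1)
    have h2' := mem_closedBall_zero_iff.1 (hR h2)
    have := norm_sub_le (x + z) x
    rw [add_sub_cancel_left] at this
    linarith
  have h := integral_mul_translate_sub (μ := μ) hv hvc z
  have h' : ∀ x, v x * (v (x + z) - v x) = -(v x ^ 2) := fun x => by
    rw [mul_sub, h0]; ring
  simp_rw [h', integral_neg] at h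
  linarith

/-- The quadratic form of the jump operator. The kernel need not be even: the skew part of the
operator does not contribute. -/
theorem integral_mul_jumpOperator {k : F → ℝ} {B : ℝ} (hkm : AEStronglyMeasurable k μ)
    (hk : ∀ z, 0 ≤ k z) (hki : Integrable (fun z => min 1 ‖z‖ * k z) μ) (hv : Continuous v)
    (hvc : HasCompactSupport v) (hB : ∀ x z, |v (x + z) - v x| ≤ B * min 1 ‖z‖) :
    Integrable (fun z => k z * translationEnergy μ v z) μ ∧
      ∫ x, v x * jumpOperator μ k v x ∂μ = -(∫ z, k z * translationEnergy μ v z ∂μ) / 2 := by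
  have hint : Integrable (fun p : F × F => v p.1 * (k p.2 * (v (p.1 + p.2) - v p.1)))
      (μ.prod μ) := by
    refine ((hv.integrable_of_hasCompactSupport hvc).norm.mul_prod
      (hki.const_mul B)).mono' ?_ (ae_of_all _ fun p => ?_)
    · exact (by fun_prop : Continuous fun p : F × F => v p.1).aestronglyMeasurable.mul
        (hkm.comp_snd.mul
          (by fun_prop : Continuous fun p : F × F => v (p.1 + p.2) - v p.1).aestronglyMeasurable)
    · rw [norm_mul]
      gcongr
      exact norm_mul_sub_le hk hB _ _
  have hinner : ∀ z, ∫ x, v x * (k z * (v (x + z) - v x)) ∂μ =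
      -(k z * translationEnergy μ v z) / 2 := fun z => by
    simp_rw [mul_left_comm (v _) (k z)]
    rw [integral_const_mul, integral_mul_translate_sub hv hvc]
    ring
  constructor
  · have := hint.integral_prod_right
    simp only [hinner] at this
    refine (this.const_mul (-2)).congr (ae_of_all _ fun z => ?_)
    ring
  · calc ∫ x, v x * jumpOperator μ k v x ∂μ
        = ∫ x, ∫ z, v x * (k z * (v (x + z) - v x)) ∂μ ∂μ := by
          simp only [jumpOperator, integral_const_mul]
      _ = ∫ z, ∫ x, v x * (k z * (v (x + z) - v x)) ∂μ ∂μ := integral_integral_swap hint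
      _ = _ := by simp only [hinner, integral_div, integral_neg]

/-- Poincaré inequality for smooth functions supported in a fixed ball. Translations by a vector of
`S` have norm at least `δ`, so that a fixed number `m` of them clears the ball. -/
theorem integral_sq_le_neg_integral_mul_jumpOperator {k : F → ℝ} (hkm : AEStronglyMeasurable k μ)
    (hk : ∀ z, 0 ≤ k z) (hki : Integrable (fun z => min 1 ‖z‖ * k z) μ)
    {S : Set F} {δ : ℝ} (hδ : 0 < δ) (hSo : IsOpen S) (hSne : S.Nonempty)
    (hSδ : ∀ z ∈ S, δ ≤ ‖z‖) (hSk : ∀ z ∈ S, 0 < k z) (R : ℝ) :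
    ∃ c : ℝ, 0 < c ∧ ∀ v : F → ℝ, ContDiff ℝ ∞ v → HasCompactSupport v →
      Function.support v ⊆ Metric.closedBall 0 R →
        c * ∫ x, v x ^ 2 ∂μ ≤ -∫ x, v x * jumpOperator μ k v x ∂μ := by
  obtain ⟨m, hm⟩ := exists_nat_gt (max 0 (2 * R / δ))
  have hm0 : (0 : ℝ) < m := (le_max_left _ _).trans_lt hm
  have hmR : 2 * R < m * δ := (div_lt_iff₀ hδ).1 ((le_max_right _ _).trans_lt hm)
  have hkS : IntegrableOn k S μ := by
    refine ((hki.const_mul (min 1 δ)⁻¹).integrableOn (s := S)).mono' hkm.restrict ?_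
    refine (ae_restrict_iff' hSo.measurableSet).2 (ae_of_all _ fun z hz => ?_)
    rw [Real.norm_of_nonneg (hk z), ← mul_assoc]
    have h1 : 0 < min 1 δ := lt_min one_pos hδ
    refine le_mul_of_one_le_left (hk z) ?_
    rw [← div_eq_inv_mul, one_le_div h1]
    exact min_le_min_left _ (hSδ z hz)
  have hI : 0 < ∫ z in S, k z ∂μ := by
    rw [setIntegral_pos_iff_support_of_nonneg_ae (ae_of_all _ hk) hkS]
    refine (hSo.measure_pos μ hSne).trans_le (measure_mono fun z hz => ⟨(hSk z hz).ne', hz⟩)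
  refine ⟨(∫ z in S, k z ∂μ) / m ^ 2, by positivity, fun v hv hvc hvR => ?_⟩
  obtain ⟨B, hB⟩ := exists_abs_sub_le_mul_min hv hvc
  obtain ⟨hE, hform⟩ := integral_mul_jumpOperator hkm hk hki hv.continuous hvc hB
  have hlow : ∀ z ∈ S, k z * (2 * (∫ x, v x ^ 2 ∂μ) / m ^ 2) ≤ k z * translationEnergy μ v z := by
    intro z hz
    refine mul_le_mul_of_nonneg_left ?_ (hk z)
    rw [div_le_iff₀' (by positivity)]
    have hnorm : 2 * R < ‖m • z‖ := by
      rw [← Nat.cast_smul_eq_nsmul ℝ, norm_smul, Real.norm_of_nonneg hm0.le]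
      exact hmR.trans_le (by gcongr; exact hSδ z hz)
    rw [← translationEnergy_eq_two_mul hv.continuous hvc hvR hnorm]
    exact translationEnergy_nsmul_le hv.continuous hvc m z
  have h1 : (∫ z in S, k z ∂μ) * (2 * (∫ x, v x ^ 2 ∂μ) / m ^ 2) ≤
      ∫ z, k z * translationEnergy μ v z ∂μ := by
    rw [← integral_mul_const]
    refine (setIntegral_mono_on (hkS.mul_const _) hE.integrableOn hSo.measurableSet hlow).trans ?_
    exact setIntegral_le_integral hE
      (ae_of_all _ fun z => mul_nonneg (hk z) (translationEnergy_nonneg z))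
  rw [hform]
  have h2 : (∫ z in S, k z ∂μ) / m ^ 2 * (∫ x, v x ^ 2 ∂μ) =
      (∫ z in S, k z ∂μ) * (2 * (∫ x, v x ^ 2 ∂μ) / m ^ 2) / 2 := by ring
  linarith

end

/-! ### Mollification and the Poincaré inequality for weak solutions -/

section

variable {k u h : F → ℝ} {R : ℝ}

theorem mollification_support_subset (φ : ContDiffBump (0 : F)) (hφ : φ.rOut ≤ 1)
    (hu : Function.support u ⊆ Metric.closedBall 0 R) :
    Function.support (φ.normed μ ⋆[ContinuousLinearMap.lsmul ℝ ℝ, μ] u) ⊆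
      Metric.closedBall 0 (R + 1) := by
  refine (support_convolution_subset _).trans ?_
  rintro _ ⟨x, hx, y, hy, rfl⟩
  rw [φ.support_normed_eq, mem_ball_zero_iff] at hx
  have := mem_closedBall_zero_iff.1 (hu hy)
  rw [mem_closedBall_zero_iff]
  exact (norm_add_le _ _).trans (by linarith)

/-- The weak equation `L* u = h`, tested with the translates of the mollification `v = ρ ⋆ u` and
averaged against `ρ`: by Fubini the averaging turns the factor `u` into a second copy of `v`. -/
theorem integral_mollification_mul_jumpOperator (hkm : AEStronglyMeasurable k μ)
    (hk : ∀ z, 0 ≤ k z) (hki : Integrable (fun z => min 1 ‖z‖ * k z) μ) (hu : Integrable u μ)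
    (hweak : ∀ ψ : F → ℝ, ContDiff ℝ ∞ ψ → HasCompactSupport ψ →
      ∫ x, u x * jumpOperator μ k ψ x ∂μ = ∫ x, h x * ψ x ∂μ)
    (φ : ContDiffBump (0 : F)) {v : F → ℝ}
    (hv : v = φ.normed μ ⋆[ContinuousLinearMap.lsmul ℝ ℝ, μ] u) (hvs : ContDiff ℝ ∞ v)
    (hvc : HasCompactSupport v) :
    Integrable (fun t => φ.normed μ t * ∫ x, h x * v (x + t) ∂μ) μ ∧
      ∫ x, v x * jumpOperator μ k v x ∂μ =
        ∫ t, φ.normed μ t * ∫ x, h x * v (x + t) ∂μ ∂μ := by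
  obtain ⟨B, hB⟩ := exists_abs_sub_le_mul_min hvs hvc
  have hLc := continuous_jumpOperator hkm hk hki hvs.continuous hB
  have hLb := norm_jumpOperator_le hk hki hB
  have htest : ∀ t, ∫ x, h x * v (x + t) ∂μ = ∫ x, u x * jumpOperator μ k v (x + t) ∂μ :=
    fun t => by
      rw [← hweak (fun x => v (x + t)) (by fun_prop) (hasCompactSupport_comp_add_right hvc t)]
      simp only [jumpOperator_comp_add_right]
  have hint : Integrable
      (fun p : F × F => φ.normed μ p.1 * (u p.2 * jumpOperator μ k v (p.2 + p.1)))
      (μ.prod μ) := by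
    have := ((φ.integrable_normed (μ := μ)).mul_prod hu).mul_bdd
      (g := fun p : F × F => jumpOperator μ k v (p.2 + p.1))
      (c := ∫ z, B * (min 1 ‖z‖ * k z) ∂μ)
      (by fun_prop : Continuous fun p : F × F => jumpOperator μ k v (p.2 + p.1)).aestronglyMeasurable
      (ae_of_all _ fun p => hLb _)
    simpa only [mul_assoc] using this
  -- The shear `(t, y) ↦ (t, y - t)` preserves the product measure.
  have hint' : Integrable
      (fun p : F × F => φ.normed μ p.1 * (u (p.2 - p.1) * jumpOperator μ k v p.2))
      (μ.prod μ) := by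
    have := (measurePreserving_prod_sub μ μ).integrable_comp_of_integrable hint
    simpa [Function.comp_def] using this
  constructor
  · have := hint.integral_prod_left
    simpa only [integral_const_mul, htest] using this
  · calc ∫ y, v y * jumpOperator μ k v y ∂μ
        = ∫ y, ∫ t, φ.normed μ t * (u (y - t) * jumpOperator μ k v y) ∂μ ∂μ := by
          congr 1 with y
          simp only [← mul_assoc]
          rw [integral_mul_const]
          congr 1
          rw [hv]
          simp [convolution_def]
      _ = ∫ t, ∫ y, φ.normed μ t * (u (y - t) * jumpOperator μ k v y) ∂μ ∂μ :=
          (integral_integral_swap hint').symm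
      _ = ∫ t, φ.normed μ t * ∫ x, h x * v (x + t) ∂μ ∂μ := by
          congr 1 with t
          rw [integral_const_mul, htest,
            ← integral_sub_right_eq_self (fun x => u x * jumpOperator μ k v (x + t)) t]
          simp only [sub_add_cancel]

theorem eLpNorm_two_eq_ofReal_sqrt {f : F → ℝ} (hf : MemLp f 2 μ) :
    eLpNorm f 2 μ = ENNReal.ofReal √(∫ x, f x ^ 2 ∂μ) := by
  rw [hf.eLpNorm_eq_integral_rpow_norm (by simp) (by simp), Real.sqrt_eq_rpow]
  simp

theorem eLpNorm_mollification_le {c : ℝ} (hc : 0 < c) (hkm : AEStronglyMeasurable k μ)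
    (hk : ∀ z, 0 ≤ k z) (hki : Integrable (fun z => min 1 ‖z‖ * k z) μ)
    (hpoin : ∀ v : F → ℝ, ContDiff ℝ ∞ v → HasCompactSupport v →
      Function.support v ⊆ Metric.closedBall 0 (R + 1) →
        c * ∫ x, v x ^ 2 ∂μ ≤ -∫ x, v x * jumpOperator μ k v x ∂μ)
    (hu : Integrable u μ) (hR : Function.support u ⊆ Metric.closedBall 0 R) (hh : MemLp h 2 μ)
    (hweak : ∀ ψ : F → ℝ, ContDiff ℝ ∞ ψ → HasCompactSupport ψ →
      ∫ x, u x * jumpOperator μ k ψ x ∂μ = ∫ x, h x * ψ x ∂μ)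
    (φ : ContDiffBump (0 : F)) (hφ : φ.rOut ≤ 1) :
    AEStronglyMeasurable (φ.normed μ ⋆[ContinuousLinearMap.lsmul ℝ ℝ, μ] u) μ ∧
    eLpNorm (φ.normed μ ⋆[ContinuousLinearMap.lsmul ℝ ℝ, μ] u) 2 μ ≤
      ENNReal.ofReal c⁻¹ * eLpNorm h 2 μ := by
  set v := φ.normed μ ⋆[ContinuousLinearMap.lsmul ℝ ℝ, μ] u with hv
  have hvs : ContDiff ℝ ∞ v :=
    φ.hasCompactSupport_normed.contDiff_convolution_left _ φ.contDiff_normed hu.locallyIntegrable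
  have hvR : Function.support v ⊆ Metric.closedBall 0 (R + 1) :=
    mollification_support_subset φ hφ hR
  have hvc : HasCompactSupport v :=
    .of_support_subset_isCompact (isCompact_closedBall 0 (R + 1)) hvR
  refine ⟨hvs.continuous.aestronglyMeasurable, ?_⟩
  have hv2 : MemLp v 2 μ := hvs.continuous.memLp_of_hasCompactSupport hvc
  have hvi : Integrable (fun x => v x ^ 2) μ := integrable_sq hvs.continuous hvc
  have hhi : Integrable (fun x => h x ^ 2) μ := hh.integrable_sq
  obtain ⟨hI, heq⟩ :=
    integral_mollification_mul_jumpOperator hkm hk hki hu hweak φ hv hvs hvc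
  set V := ∫ x, v x ^ 2 ∂μ with hV
  set H := ∫ x, h x ^ 2 ∂μ with hH
  -- Young's inequality with the weight that lets the `v` term be absorbed.
  have hyoung : ∀ t, -(∫ x, h x * v (x + t) ∂μ) ≤ H / (2 * c) + c / 2 * V := fun t => by
    have hvt : Integrable (fun x => v (x + t) ^ 2) μ := hvi.comp_add_right t
    have hVt : ∫ x, v (x + t) ^ 2 ∂μ = V := integral_add_right_eq_self (fun x => v x ^ 2) t
    have hvt2 : MemLp (fun x => v (x + t)) 2 μ :=
      (by fun_prop : Continuous fun x => v (x + t)).memLp_of_hasCompactSupport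
        (hasCompactSupport_comp_add_right hvc t)
    rw [← integral_neg, ← hVt, hH, ← integral_div, ← integral_const_mul,
      ← integral_add (hhi.div_const _) (hvt.const_mul _)]
    refine integral_mono (hh.integrable_mul hvt2).neg
      ((hhi.div_const _).add (hvt.const_mul _)) fun x => ?_
    have hsq : h x ^ 2 / (2 * c) + c / 2 * v (x + t) ^ 2 - -(h x * v (x + t)) =
        (h x + c * v (x + t)) ^ 2 / (2 * c) := by
      field_simp
      ring
    have : 0 ≤ (h x + c * v (x + t)) ^ 2 / (2 * c) := by positivity
    simp only
    linarith
  have h1 : -∫ x, v x * jumpOperator μ k v x ∂μ ≤ H / (2 * c) + c / 2 * V := by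
    rw [heq, ← integral_neg]
    calc ∫ t, -(φ.normed μ t * ∫ x, h x * v (x + t) ∂μ) ∂μ
        ≤ ∫ t, φ.normed μ t * (H / (2 * c) + c / 2 * V) ∂μ := by
          refine integral_mono hI.neg (φ.integrable_normed.mul_const _) fun t => ?_
          have := mul_le_mul_of_nonneg_left (hyoung t) (φ.nonneg_normed (μ := μ) t)
          simp only
          linarith
      _ = _ := by rw [integral_mul_const, φ.integral_normed, one_mul]
  have h2 : V ≤ (c⁻¹) ^ 2 * H := by
    have h3 := (hpoin v hvs hvc hvR).trans h1
    have h4 : H / (2 * c) = c / 2 * ((c⁻¹) ^ 2 * H) := by field_simp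
    rw [h4] at h3
    have h5 : c / 2 * V ≤ c / 2 * ((c⁻¹) ^ 2 * H) := by linarith
    exact le_of_mul_le_mul_left h5 (by positivity)
  rw [eLpNorm_two_eq_ofReal_sqrt hv2, eLpNorm_two_eq_ofReal_sqrt hh,
    ← ENNReal.ofReal_mul (by positivity)]
  refine ENNReal.ofReal_le_ofReal ((Real.sqrt_le_sqrt h2).trans_eq ?_)
  rw [Real.sqrt_mul (by positivity), Real.sqrt_sq (by positivity)]

/-- Poincaré inequality for weak solutions supported in a fixed ball. The bound for the mollifications
passes to the limit by Fatou's lemma, so that their convergence in `L²` is not needed. -/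
theorem exists_eLpNorm_le_of_weak (hkm : AEStronglyMeasurable k μ)
    (hk : ∀ z, 0 ≤ k z) (hki : Integrable (fun z => min 1 ‖z‖ * k z) μ)
    {S : Set F} {δ : ℝ} (hδ : 0 < δ) (hSo : IsOpen S) (hSne : S.Nonempty)
    (hSδ : ∀ z ∈ S, δ ≤ ‖z‖) (hSk : ∀ z ∈ S, 0 < k z) (R : ℝ) :
    ∃ C : ℝ, 0 < C ∧ ∀ u h : F → ℝ, Integrable u μ →
      Function.support u ⊆ Metric.closedBall 0 R → MemLp h 2 μ →
      (∀ ψ : F → ℝ, ContDiff ℝ ∞ ψ → HasCompactSupport ψ →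
        ∫ x, u x * jumpOperator μ k ψ x ∂μ = ∫ x, h x * ψ x ∂μ) →
      eLpNorm u 2 μ ≤ ENNReal.ofReal C * eLpNorm h 2 μ := by
  obtain ⟨c, hc, hpoin⟩ :=
    integral_sq_le_neg_integral_mul_jumpOperator hkm hk hki hδ hSo hSne hSδ hSk (R + 1)
  refine ⟨c⁻¹, by positivity, fun u h hu hR hh hweak => ?_⟩
  let φ : ℕ → ContDiffBump (0 : F) := fun n =>
    ⟨(1 / ((n : ℝ) + 1)) / 2, 1 / ((n : ℝ) + 1), by positivity, half_lt_self (by positivity)⟩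
  have hφ1 : ∀ n, (φ n).rOut ≤ 1 := fun n => by
    simp only [φ]
    rw [div_le_one (by positivity)]
    linarith [(Nat.cast_nonneg n : (0 : ℝ) ≤ n)]
  have hmain := fun n =>
    eLpNorm_mollification_le hc hkm hk hki hpoin hu hR hh hweak (φ n) (hφ1 n)
  have hlim := ContDiffBump.ae_convolution_tendsto_right_of_locallyIntegrable (μ := μ) (φ := φ)
    (K := 2) tendsto_one_div_add_atTop_nhds_zero_nat
    (.of_forall fun n => by simp only [φ]; linarith) hu.locallyIntegrable
  refine (Lp.eLpNorm_lim_le_liminf_eLpNorm (fun n => (hmain n).1) u hlim).trans ?_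
  exact liminf_le_of_le (by isBoundedDefault) fun b hb => by
    obtain ⟨n, hn⟩ := hb.exists
    exact hn.trans (hmain n).2

end

end JumpOperator

/-! ### The scalar kernel of the half-ball gradient in the direction `ν` -/

/-- The jump kernel `k(z) = χ_{-ν}(z) |z · ν| / |z| w(z)`. On `{z | z · (-ν) ≥ 0}` the sign in front
of the inner product makes it nonnegative. It vanishes at the origin, whatever the value of `w`. -/
noncomputable def halfBallKernel {d : ℕ} (w : E d → ℝ) (ν : E d) (z : E d) : ℝ :=
  -(halfSpaceChar (-ν) z * inner ℝ (‖z‖⁻¹ • z) ν * w z)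

section

variable {d : ℕ} {w : E d → ℝ} {ν : E d}

theorem measurable_halfSpaceChar (ν : E d) : Measurable (halfSpaceChar ν) :=
  measurable_const.indicator (isClosed_le continuous_const (by fun_prop)).measurableSet

theorem abs_halfSpaceChar_le (ν z : E d) : |halfSpaceChar ν z| ≤ 1 := by
  by_cases h : z ∈ {z : E d | 0 ≤ inner ℝ z ν}
  · simp [halfSpaceChar, Set.indicator_of_mem h]
  · simp [halfSpaceChar, Set.indicator_of_notMem h]

theorem halfBallKernel_nonneg (hw : IsKernel w) (z : E d) : 0 ≤ halfBallKernel w ν z := by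
  rcases eq_or_ne z 0 with rfl | hz
  · simp [halfBallKernel]
  have hwz := hw.nonneg z hz
  by_cases h : z ∈ {z : E d | 0 ≤ inner ℝ z (-ν)}
  · have h' : 0 ≤ -inner ℝ z ν := by simpa using h
    have : halfBallKernel w ν z = ‖z‖⁻¹ * -inner ℝ z ν * w z := by
      simp only [halfBallKernel, halfSpaceChar, Set.indicator_of_mem h, real_inner_smul_left]
      ring
    rw [this]
    positivity
  · rw [halfBallKernel, halfSpaceChar, Set.indicator_of_notMem h, zero_mul, zero_mul, neg_zero]

theorem halfBallKernel_pos {z : E d} (hz : inner ℝ z ν < 0) (hwz : 0 < w z) :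
    0 < halfBallKernel w ν z := by
  have h : z ∈ {z : E d | 0 ≤ inner ℝ z (-ν)} := by simpa using hz.le
  have hz0 : 0 < ‖z‖ := norm_pos_iff.2 (by rintro rfl; simp at hz)
  have : halfBallKernel w ν z = ‖z‖⁻¹ * -inner ℝ z ν * w z := by
    simp only [halfBallKernel, halfSpaceChar, Set.indicator_of_mem h, real_inner_smul_left]
    ring
  rw [this]
  have : 0 < -inner ℝ z ν := by linarith
  positivity

theorem measurable_halfSpaceChar_mul_inner (ν : E d) :
    Measurable fun z : E d => halfSpaceChar (-ν) z * inner ℝ (‖z‖⁻¹ • z) ν :=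
  (measurable_halfSpaceChar _).mul (by fun_prop)

theorem aestronglyMeasurable_halfBallKernel (hw : IsKernel w) (ν : E d) :
    AEStronglyMeasurable (halfBallKernel w ν) volume := by
  -- Away from the origin `w` is recovered from the measurable function `min (1, |z|) w(z)`.
  have heq : halfBallKernel w ν = fun z => -(halfSpaceChar (-ν) z * inner ℝ (‖z‖⁻¹ • z) ν *
      ((min 1 ‖z‖)⁻¹ * (min 1 ‖z‖ * w z))) := by
    ext z
    rcases eq_or_ne z 0 with rfl | hz
    · simp [halfBallKernel]
    · have : min 1 ‖z‖ ≠ 0 := (lt_min one_pos (norm_pos_iff.2 hz)).ne'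
      rw [inv_mul_cancel_left₀ this, halfBallKernel]
  have hm : Measurable fun z : E d => (min 1 ‖z‖)⁻¹ := by fun_prop
  rw [heq]
  exact ((measurable_halfSpaceChar_mul_inner ν).aestronglyMeasurable.mul
    (hm.aestronglyMeasurable.mul hw.integrable_min.aestronglyMeasurable)).neg

theorem integrable_min_mul_halfBallKernel (hw : IsKernel w) (hν : ‖ν‖ = 1) :
    Integrable (fun z => min 1 ‖z‖ * halfBallKernel w ν z) volume := by
  have h := (hw.integrable_min.bdd_mul (c := 1)
    (measurable_halfSpaceChar_mul_inner ν).aestronglyMeasurable (ae_of_all _ fun z => ?_)).neg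
  · refine h.congr (ae_of_all _ fun z => ?_)
    simp only [Pi.neg_apply, halfBallKernel]
    ring
  · rw [norm_mul]
    refine mul_le_one₀ (abs_halfSpaceChar_le _ _) (norm_nonneg _) ?_
    refine (norm_inner_le_norm _ _).trans ?_
    rw [hν, mul_one, norm_smul, norm_inv, norm_norm]
    exact inv_mul_le_one

/-- On fields `ψ ν` the principal value is an absolutely convergent integral. -/
theorem nonlocalDiv_neg_smul_eq (hw : IsKernel w) (hν : ‖ν‖ = 1) {ψ : E d → ℝ}
    (hψ : ContDiff ℝ ∞ ψ) (hc : HasCompactSupport ψ) (x : E d) :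
    nonlocalDiv w (-ν) (fun y => ψ y • ν) x =
      -jumpOperator volume (halfBallKernel w ν) ψ x := by
  obtain ⟨B, hB⟩ := exists_abs_sub_le_mul_min hψ hc
  set G : E d → ℝ := fun y => -(halfBallKernel w ν (y - x) * (ψ y - ψ x)) with hG
  have hGi : Integrable G volume := by
    have := ((integrable_jump (aestronglyMeasurable_halfBallKernel hw ν)
      (halfBallKernel_nonneg hw) (integrable_min_mul_halfBallKernel hw hν)
      hψ.continuous hB x).comp_sub_right x).neg
    simpa only [hG, add_sub_cancel] using! this
  have hGint : ∫ y, G y = -jumpOperator volume (halfBallKernel w ν) ψ x := by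
    rw [← integral_add_left_eq_self G x, jumpOperator, ← integral_neg]
    simp only [hG, add_sub_cancel_left]
  have hpt : ∀ y, halfSpaceChar (-ν) (y - x) *
      inner ℝ (‖y - x‖⁻¹ • (y - x)) (ψ y • ν - ψ x • ν) * w (y - x) = G y := fun y => by
    simp only [hG, ← sub_smul, real_inner_smul_right, halfBallKernel]
    ring
  have hlim : Tendsto (fun ε => ∫ y in (Metric.ball x ε)ᶜ, G y) (𝓝[>] (0 : ℝ))
      (𝓝 (∫ y, G y)) := by
    have hms : ∀ ε : ℝ, MeasurableSet (Metric.ball x ε)ᶜ := fun ε => measurableSet_ball.compl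
    simp_rw [fun ε => (integral_indicator (μ := volume) (f := G) (hms ε)).symm]
    refine tendsto_integral_filter_of_dominated_convergence (fun y => ‖G y‖)
      (.of_forall fun ε => hGi.aestronglyMeasurable.indicator (hms ε))
      (.of_forall fun ε => ae_of_all _ fun y => norm_indicator_le_norm_self _ _) hGi.norm
      (ae_of_all _ fun y => ?_)
    rcases eq_or_ne y x with rfl | hy
    · have : G y = 0 := by simp [hG]
      refine tendsto_const_nhds.congr fun ε => ?_
      rw [this, Set.indicator_apply_eq_zero.2 fun _ => this]
    · refine tendsto_const_nhds.congr' ?_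
      filter_upwards [Ioo_mem_nhdsGT (dist_pos.2 hy)] with ε hε
      rw [Set.indicator_of_mem]
      simpa using hε.2.le
  unfold nonlocalDiv
  simp only [hpt]
  rw [hlim.limUnder_eq, hGint]

/-- The component along `ν` of the distributional gradient solves a scalar weak equation. -/
theorem IsL2Gradient.integral_mul_jumpOperator_eq (hw : IsKernel w) (hν : ‖ν‖ = 1)
    {u : E d → ℝ} {g : E d → E d} (hg : IsL2Gradient w ν u g) {ψ : E d → ℝ}
    (hψ : ContDiff ℝ ∞ ψ) (hc : HasCompactSupport ψ) :
    ∫ x, u x * jumpOperator volume (halfBallKernel w ν) ψ x = ∫ x, inner ℝ (g x) ν * ψ x := by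
  have h := hg.2 (fun x => ψ x • ν) (by fun_prop) hc.smul_right
  simp only [distribGrad, nonlocalDiv_neg_smul_eq hw hν hψ hc, mul_neg, integral_neg, neg_neg,
    real_inner_smul_right] at h
  rw [h]
  simp only [mul_comm]

end

end NonlocalHalfBall

open NonlocalHalfBall in
theorem theorem5p1 {d : ℕ} (w : E d → ℝ) (hw : IsKernel w)
    (hw' : HasFiniteFirstMoment w ∨ IsFractionalAtInfinity w)
    (ν : E d) (hν : ‖ν‖ = 1)
    (Ω : Set (E d)) (hΩo : IsOpen Ω) (hΩc : IsConnected Ω) (hΩb : Bornology.IsBounded Ω)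
    (hΩ : HasContinuousBoundary Ω) :
    ∃ C : ℝ, 0 < C ∧ ∀ u ∈ nonlocalSobolev w ν Ω, ∀ g, IsL2Gradient w ν u g →
      eLpNorm u 2 (volume.restrict Ω) ≤ ENNReal.ofReal C * eLpNorm g 2 volume := by
  obtain ⟨ε, hε, -, hpos⟩ := hw.pos_near_zero
  obtain ⟨R, hR⟩ := hΩb.subset_closedBall (0 : E d)
  have hSo : IsOpen {z : E d | inner ℝ z ν < 0 ∧ ε / 2 < ‖z‖ ∧ ‖z‖ < ε} := by
    have hin : Continuous fun z : E d => inner ℝ z ν := by fun_prop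
    refine (isOpen_lt hin continuous_const).inter ?_
    exact (isOpen_lt continuous_const continuous_norm).inter
      (isOpen_lt continuous_norm continuous_const)
  have hSne : {z : E d | inner ℝ z ν < 0 ∧ ε / 2 < ‖z‖ ∧ ‖z‖ < ε}.Nonempty := by
    refine ⟨-(3 / 4 * ε) • ν, ?_, ?_⟩
    · rw [real_inner_smul_left, real_inner_self_eq_norm_sq, hν]
      linarith
    · rw [norm_smul, hν, norm_neg, Real.norm_of_nonneg (by positivity)]
      constructor <;> linarith
  obtain ⟨C, hC, hmain⟩ := exists_eLpNorm_le_of_weak (μ := (volume : Measure (E d)))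
    (aestronglyMeasurable_halfBallKernel hw ν) (halfBallKernel_nonneg hw)
    (integrable_min_mul_halfBallKernel hw hν) (half_pos hε) hSo hSne (fun z hz => hz.2.1.le)
    (fun z hz => halfBallKernel_pos hz.1
      (hpos z ((half_pos hε).trans hz.2.1) hz.2.2.le)) R
  refine ⟨C, hC, fun u ⟨hu, hu0, _⟩ g hg => ?_⟩
  have hae : Ω.indicator u =ᵐ[volume] u := by
    filter_upwards [hu0] with x hx
    by_cases h : x ∈ Ω
    · rw [Set.indicator_of_mem h]
    · rw [Set.indicator_of_notMem h, hx h]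
  have hui : Integrable (Ω.indicator u) volume := by
    have : IsFiniteMeasure (volume.restrict Ω) := ⟨by simpa using hΩb.measure_lt_top⟩
    exact (integrable_indicator_iff hΩo.measurableSet).2 ((hu.restrict Ω).integrable (by norm_num))
  have hsupp : Function.support (Ω.indicator u) ⊆ Metric.closedBall 0 R :=
    Set.support_indicator_subset.trans hR
  have hgν : ∀ x, ‖inner ℝ (g x) ν‖ ≤ ‖g x‖ := fun x =>
    (norm_inner_le_norm _ _).trans_eq (by rw [hν, mul_one])
  have hh : MemLp (fun x => inner ℝ (g x) ν) 2 volume :=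
    hg.1.mono (hg.1.aestronglyMeasurable.inner aestronglyMeasurable_const) (ae_of_all _ hgν)
  have hweak : ∀ ψ : E d → ℝ, ContDiff ℝ ∞ ψ → HasCompactSupport ψ →
      ∫ x, Ω.indicator u x * jumpOperator volume (halfBallKernel w ν) ψ x =
        ∫ x, inner ℝ (g x) ν * ψ x := fun ψ hψ hc => by
    rw [← hg.integral_mul_jumpOperator_eq hw hν hψ hc]
    exact integral_congr_ae (by filter_upwards [hae] with x hx; rw [hx])
  calc eLpNorm u 2 (volume.restrict Ω)
      ≤ eLpNorm u 2 volume := eLpNorm_restrict_le _ _ _ _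
    _ = eLpNorm (Ω.indicator u) 2 volume := (eLpNorm_congr_ae hae).symm
    _ ≤ ENNReal.ofReal C * eLpNorm (fun x => inner ℝ (g x) ν) 2 volume :=
        hmain _ _ hui hsupp hh hweak
    _ ≤ ENNReal.ofReal C * eLpNorm g 2 volume := by
        gcongr
        exact eLpNorm_mono hgν
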